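/- Graphs are finite and undirected and may have loops and parallel edges. A graph is called 2-connected if it is connected (in particular non-empty), has no loops, and has no vertex whose deletion leaves two vertices that are not joined by a path. A matroid with ground set $E$ and rank function $r$ is called 2-connected if there is no set $\emptyset\neq X\subsetneq E$ with $r(E)=r(X)+r(E\setminus X)$. For a 2-connected matroid $M$ on $E$, a subset $L\subseteq E$ is called locked in $M$ if $M|L$ and $M^*|(E\setminus L)$ are 2-connected, $r(L)\ge 2$ and $r^*(E\setminus L)\ge 2$, where $M^*$ is the dual matroid and $r^*$ is its rank function. For a connected graph $G$, let $M(G)$ be the graphic matroid on $E(G)$, whose bases are the edge sets of the spanning trees of $G$. **Theorem.** Let $G$ be a 2-connected graph and let $H$ be a subgraph of $G$. Let $\overline H$ be the subgraph of $G$ whose edges are the edges in $E(G)\setminus E(H)$ and whose vertices are the vertices of $G$ incident to at least one of these edges. Then the following are equivalent. (a) $H$ has no isolated vertices, and $E(H)$ is a locked subset of $M(G)$. (b) All of the following four conditions hold: 1. $H$ is an induced subgraph of $G$, and $H$ is 2-connected; 2. $3\le |V(H)|\le |V(G)|-1$; 3. $|E(\overline H)|\ge |V(\overline H)|$ or $|V(H)\cap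 V(\overline H)|\ge 3$; 4. the subgraph of $G$ induced by $V(G)\setminus V(H)$ is connected. -/

import Mathlib

/-! Graphs are Mathlib's `Graph α β`: undirected graphs in which loops and parallel edges are
allowed, with vertex set `V(G)`, edge set `E(G)` and incidence `G.IsLink e x y`. -/

open Set
open scoped Graph Matroid

namespace Graph

variable {α β : Type*}

/-! ### Connectivity of graphs -/

/-- Any two vertices of `G` are joined by a walk of `G`. -/
def Preconnected (G : Graph α β) : Prop :=
  ∀ x ∈ V(G), ∀ y ∈ V(G), Relation.ReflTransGen G.Adj x y

/-- `G` is nonempty, and any two of its vertices are joined by a walk. -/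
def Connected (G : Graph α β) : Prop :=
  V(G).Nonempty ∧ G.Preconnected

/-- `G` is 2-connected (nonseparable): it is connected and has neither loops nor cut vertices.
No lower bound on the number of vertices is imposed, so that, as for matroids, a single edge and
a bundle of parallel edges are 2-connected. -/
structure TwoConnected (G : Graph α β) : Prop where
  connected : G.Connected
  loopless : G.Loopless
  preconnected_deleteVerts : ∀ v ∈ V(G), (G.deleteVerts {v}).Preconnected

/-! ### Subgraphs spanned by edges -/

/-- `V(F)`: the set of the vertices of `G` that are incident to some edge in `F`. -/
def incidentVerts (G : Graph α β) (F : Set β) : Set α :=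
  {x | ∃ e ∈ F, G.Inc e x}

/-- The complementary subgraph of `H` in `G`: its edges are the edges of `G` that are not edges
of `H`, and its vertices are the vertices of `G` that are incident to at least one such edge. -/
def complementary (G H : Graph α β) : Graph α β :=
  (G.deleteEdges E(H)).induce (G.incidentVerts (E(G) \ E(H)))

lemma vertexSet_complementary (G H : Graph α β) :
    V(G.complementary H) = G.incidentVerts (E(G) \ E(H)) := rfl

lemma complementary_isLink (G H : Graph α β) {e : β} {x y : α} :
    (G.complementary H).IsLink e x y ↔ G.IsLink e x y ∧ e ∉ E(H) := by
  constructor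
  · rintro ⟨h, -, -⟩
    exact h
  · rintro ⟨h, he⟩
    have hm : e ∈ E(G) \ E(H) := ⟨h.edge_mem, he⟩
    exact ⟨⟨h, he⟩, ⟨e, hm, h.inc_left⟩, ⟨e, hm, h.inc_right⟩⟩

lemma edgeSet_complementary (G H : Graph α β) :
    E(G.complementary H) = E(G) \ E(H) := by
  ext e
  rw [edgeSet_eq_setOfPred_exists_isLink]
  constructor
  · rintro ⟨x, y, h⟩
    rw [complementary_isLink] at h
    exact ⟨h.1.edge_mem, h.2⟩
  · rintro ⟨he, heH⟩
    obtain ⟨x, y, h⟩ := exists_isLink_of_mem_edgeSet he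
    exact ⟨x, y, (complementary_isLink G H).2 ⟨h, heH⟩⟩

/-! ### Cycles and forests -/

/-- The vertices `v 0, …, v k` and the edges `e 0, …, e k` form a cycle of length `k + 1`: the
vertices are distinct, the edges are distinct, and `e i` joins `v i` to `v (i + 1)`, indices being
taken modulo `k + 1`. A loop is a cycle of length 1, two parallel edges form one of length 2. -/
def IsCycle (G : Graph α β) {k : ℕ} (v : Fin (k + 1) → α) (e : Fin (k + 1) → β) : Prop :=
  Function.Injective v ∧ Function.Injective e ∧ ∀ i, G.IsLink (e i) (v i) (v (i + 1))

/-- `G` is a forest: it has no cycles. -/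
def Acyclic (G : Graph α β) : Prop :=
  ∀ (k : ℕ) (v : Fin (k + 1) → α) (e : Fin (k + 1) → β), ¬ G.IsCycle v e

lemma Acyclic.anti {G H : Graph α β} (hG : G.Acyclic) (hHG : H ≤ G) : H.Acyclic :=
  fun k v e h ↦ hG k v e ⟨h.1, h.2.1, fun i ↦ (h.2.2 i).mono hHG⟩

lemma reflTransGen_adj_symm {G : Graph α β} {x y : α} (h : Relation.ReflTransGen G.Adj x y) :
    Relation.ReflTransGen G.Adj y x := by
  induction h with
  | refl => exact .refl
  | tail _ h ih => exact Relation.ReflTransGen.head ((adj_comm ..).1 h) ih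

/-- If the ends of an edge outside `F` are joined by a walk in `F`, the edge closes a cycle. -/
lemma not_acyclic_restrict_insert {G : Graph α β} {F : Set β} {e : β} {x y : α} (he : e ∉ F)
    (hxy : G.IsLink e x y) (h : Relation.ReflTransGen (G.restrict F).Adj x y) :
    ¬ (G.restrict (insert e F)).Acyclic := by
  classical
  set S : SimpleGraph α := SimpleGraph.fromRel (G.restrict F).Adj with hS
  have hreach : S.Reachable x y := by
    clear hxy
    induction h with
    | refl => exact SimpleGraph.Reachable.refl _
    | @tail b c _ hbc ih =>
      by_cases hne : b = c
      · exact hne ▸ ih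
      · exact ih.trans (SimpleGraph.Adj.reachable ((SimpleGraph.fromRel_adj ..).2 ⟨hne, .inl hbc⟩))
  obtain ⟨p, hp⟩ := hreach.exists_isPath
  have hadj : ∀ i, i < p.length → ∃ f, f ∈ F ∧ G.IsLink f (p.getVert i) (p.getVert (i + 1)) := by
    intro i hi
    have h1 := p.adj_getVert_succ hi
    replace h1 := (SimpleGraph.fromRel_adj ..).1 h1
    rcases h1.2 with ⟨f, hf⟩ | ⟨f, hf⟩
    · exact ⟨f, hf.1, hf.2⟩
    · exact ⟨f, hf.1, hf.2.symm⟩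
  have hex : ∀ i : ℕ, ∃ f, (i < p.length → f ∈ F ∧
      G.IsLink f (p.getVert i) (p.getVert (i + 1))) ∧ (¬ i < p.length → f = e) := by
    intro i
    by_cases hi : i < p.length
    · obtain ⟨f, hf⟩ := hadj i hi
      exact ⟨f, fun _ ↦ hf, fun h ↦ absurd hi h⟩
    · exact ⟨e, fun h ↦ absurd h hi, fun _ ↦ rfl⟩
  choose c hc hc' using hex
  have hinj : ∀ {i j : ℕ}, i ≤ p.length → j ≤ p.length → p.getVert i = p.getVert j → i = j :=
    fun hi hj hij ↦ hp.getVert_injOn hi hj hij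
  intro hac
  refine hac p.length (fun i ↦ p.getVert i) (fun i ↦ c i) ⟨?_, ?_, ?_⟩
  · intro i j hij
    exact Fin.ext (hinj (by omega) (by omega) hij)
  · intro i j hij
    apply Fin.ext
    by_cases hi : (i : ℕ) < p.length <;> by_cases hj : (j : ℕ) < p.length
    · have hi2 := (hc i hi).2
      have hj2 := (hc j hj).2
      have hij' : c i = c j := hij
      rw [hij'] at hi2
      rcases hi2.eq_and_eq_or_eq_and_eq hj2 with h1 | h1
      · exact hinj (by omega) (by omega) h1.1
      · have h2 := hinj (by omega) (by omega) h1.1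
        have h3 := hinj (by omega) (by omega) h1.2
        omega
    · have hij' : c i = c j := hij
      exact absurd (hc' j hj ▸ hij' ▸ (hc i hi).1) he
    · have hij' : c i = c j := hij
      exact absurd (hc' i hi ▸ hij'.symm ▸ (hc j hj).1) he
    · omega
  · intro i
    by_cases hi : (i : ℕ) < p.length
    · have hlast : i ≠ Fin.last _ := by
        intro h
        rw [h] at hi
        simp at hi
      have hval : ((i + 1 : Fin (p.length + 1)) : ℕ) = i + 1 := by
        rw [Fin.val_add_one, if_neg hlast]
      have h1 := hc i hi
      simp only [restrict_isLink]
      rw [hval]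
      exact ⟨.inr h1.1, h1.2⟩
    · have hlast : i = Fin.last _ := Fin.ext (by simp; omega)
      simp only [restrict_isLink]
      rw [hc' i hi, hlast]
      simpa using hxy.symm

open scoped Fin.CommRing in
/-- Adding to a forest an edge whose ends lie in different components gives a forest. -/
lemma acyclic_restrict_insert {G : Graph α β} {F : Set β} {e : β} {x y : α}
    (hxy : G.IsLink e x y) (hF : (G.restrict F).Acyclic)
    (h : ¬ Relation.ReflTransGen (G.restrict F).Adj x y) :
    (G.restrict (insert e F)).Acyclic := by
  intro k v c ⟨hv, hc, hl⟩
  by_cases hmem : ∃ i, c i = e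
  · obtain ⟨i, hi⟩ := hmem
    have key : ∀ j : ℕ, j ≤ k →
        Relation.ReflTransGen (G.restrict F).Adj (v (i + 1)) (v (i + 1 + (j : Fin (k + 1)))) := by
      intro j
      induction j with
      | zero => intro _; simpa using Relation.ReflTransGen.refl
      | succ j ih =>
        intro hj
        refine (ih (by omega)).tail ⟨c (i + 1 + (j : Fin (k + 1))), ?_⟩
        have hl' := hl (i + 1 + (j : Fin (k + 1)))
        simp only [restrict_isLink] at hl' ⊢
        refine ⟨hl'.1.resolve_left ?_, ?_⟩
        · intro he
          have h0 := hc (he.trans hi.symm)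
          rw [add_assoc, add_eq_left] at h0
          have h1 : ((j + 1 : ℕ) : Fin (k + 1)) = 0 := by
            push_cast
            linear_combination h0
          rw [Fin.natCast_eq_zero] at h1
          have := Nat.le_of_dvd (by omega) h1
          omega
        · have h2 := hl'.2
          push_cast
          rw [← add_assoc]
          exact h2
    have hk := key k le_rfl
    have h0 : i + 1 + (k : Fin (k + 1)) = i := by
      rw [add_assoc, add_eq_left]
      have : ((k + 1 : ℕ) : Fin (k + 1)) = 0 := by simp
      push_cast at this
      linear_combination this
    rw [h0] at hk
    have hli := hl i
    rw [hi] at hli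
    rcases hli.2.eq_and_eq_or_eq_and_eq hxy with h1 | h1
    · rw [h1.1, h1.2] at hk
      exact h (reflTransGen_adj_symm hk)
    · rw [h1.1, h1.2] at hk
      exact h hk
  · refine hF k v c ⟨hv, hc, fun i ↦ ?_⟩
    have := hl i
    simp only [restrict_isLink] at this ⊢
    exact ⟨this.1.resolve_left fun h ↦ hmem ⟨i, h⟩, this.2⟩

/-- `F` is the edge set of a forest of `G`. -/
def IsForestSet (G : Graph α β) (F : Set β) : Prop :=
  F ⊆ E(G) ∧ (G.restrict F).Acyclic

lemma IsForestSet.subset {G : Graph α β} {F F' : Set β} (h : G.IsForestSet F) (hss : F' ⊆ F) :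
    G.IsForestSet F' :=
  ⟨hss.trans h.1, h.2.anti (restrict_mono_right G hss)⟩

lemma reflTransGen_of_maximal {G : Graph α β} {B : Set β} (hB : Maximal G.IsForestSet B) {e : β}
    {x y : α} (he : G.IsLink e x y) : Relation.ReflTransGen (G.restrict B).Adj x y := by
  by_contra hcon
  have hins : G.IsForestSet (insert e B) :=
    ⟨insert_subset he.edge_mem hB.prop.1, acyclic_restrict_insert he hB.prop.2 hcon⟩
  have heB : e ∈ B := hB.le_of_ge hins (subset_insert _ _) (mem_insert _ _)
  exact hcon (.single ⟨e, heB, he⟩)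

/-! ### The graphic matroid -/

/-- The graphic (cycle) matroid `M(G)`: its ground set is `E(G)`, and its independent sets are
the edge sets of the forests of `G`. -/
def graphicMatroid (G : Graph α β) : Matroid β :=
  (IndepMatroid.ofFinitary E(G) G.IsForestSet
    (indep_empty := ⟨empty_subset _, fun _ _ _ h ↦ (h.2.2 0).1⟩)
    (indep_subset := fun _ _ hJ hIJ ↦ hJ.subset hIJ)
    (indep_aug := by
      intro I B hI hImax hB
      by_contra! hcon
      have hBI : ∀ {a b}, Relation.ReflTransGen (G.restrict B).Adj a b →
          Relation.ReflTransGen (G.restrict I).Adj a b := by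
        intro a b hab
        induction hab with
        | refl => exact .refl
        | @tail b c _ hbc ih =>
          obtain ⟨f, hfB, hf⟩ := hbc
          refine ih.trans ?_
          by_cases hfI : f ∈ I
          · exact .single ⟨f, hfI, hf⟩
          · by_contra hn
            exact hcon f ⟨hfB, hfI⟩
              ⟨insert_subset hf.edge_mem hI.1, acyclic_restrict_insert hf hI.2 hn⟩
      obtain ⟨J, hJ, hIJ⟩ : ∃ J, G.IsForestSet J ∧ I ⊂ J := by
        by_contra! hno
        refine hImax ⟨hI, fun J hJ hIJ ↦ ?_⟩
        by_contra hJI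
        exact hno J hJ ⟨hIJ, hJI⟩
      obtain ⟨e, heJ, heI⟩ := exists_of_ssubset hIJ
      obtain ⟨x, y, hxy⟩ := exists_isLink_of_mem_edgeSet (hJ.1 heJ)
      exact not_acyclic_restrict_insert heI hxy (hBI (reflTransGen_of_maximal hB hxy))
        (hJ.subset (insert_subset heJ hIJ.subset)).2)
    (indep_compact := by
      intro I hI
      refine ⟨fun e he ↦ ?_, fun k v c h ↦ ?_⟩
      · exact (hI {e} (by simpa using he) (finite_singleton e)).1 rfl
      · refine (hI (range c) ?_ (finite_range c)).2 k v c
          ⟨h.1, h.2.1, fun i ↦ ⟨mem_range_self i, (h.2.2 i).2⟩⟩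
        rintro _ ⟨i, rfl⟩
        exact (h.2.2 i).1)
    (subset_ground := fun _ h ↦ h.1)).matroid

@[simp] lemma graphicMatroid_ground (G : Graph α β) : G.graphicMatroid.E = E(G) := rfl

@[simp] lemma graphicMatroid_indep (G : Graph α β) {F : Set β} :
    G.graphicMatroid.Indep F ↔ F ⊆ E(G) ∧ (G.restrict F).Acyclic := Iff.rfl

/-- The bases of the graphic matroid of a connected graph are its spanning trees. -/
lemma graphicMatroid_isBase_iff {G : Graph α β} (hG : G.Connected) {T : Set β} :
    G.graphicMatroid.IsBase T ↔
      T ⊆ E(G) ∧ (G.restrict T).Connected ∧ (G.restrict T).Acyclic := by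
  rw [Matroid.isBase_iff_maximal_indep]
  constructor
  · intro h
    refine ⟨h.prop.1, ⟨hG.1, fun x hx y hy ↦ ?_⟩, h.prop.2⟩
    have hreach := hG.2 x hx y hy
    clear hy
    induction hreach with
    | refl => exact .refl
    | @tail b c _ hbc ih =>
      obtain ⟨e, he⟩ := hbc
      exact ih.trans (reflTransGen_of_maximal h he)
  · rintro ⟨hT, hconn, hac⟩
    refine ⟨⟨hT, hac⟩, fun J hJ hTJ e heJ ↦ ?_⟩
    by_contra heT
    obtain ⟨x, y, hxy⟩ := exists_isLink_of_mem_edgeSet (hJ.1 heJ)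
    exact not_acyclic_restrict_insert heT hxy (hconn.2 x hxy.left_mem y hxy.right_mem)
      (IsForestSet.subset hJ (insert_subset heJ hTJ)).2

end Graph

namespace Matroid

variable {β : Type*}

/-- `M` is 2-connected: there is no nonempty proper subset `X` of the ground set with
`r(E) = r(X) + r(E \ X)`. (Ranks are extended natural numbers; the notion is meant for matroids
of finite rank.) -/
def TwoConnected (M : Matroid β) : Prop :=
  ∀ X, X.Nonempty → X ⊂ M.E → M.eRk M.E ≠ M.eRk X + M.eRk (M.E \ X)

/-- `L` is a locked subset of the (2-connected) matroid `M`: both `M|L` and `M*|(E \ L)` are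
2-connected, and `r(L)` and `r*(E \ L)` are at least 2. -/
structure IsLocked (M : Matroid β) (L : Set β) : Prop where
  subset_ground : L ⊆ M.E
  twoConnected_restrict : (M ↾ L).TwoConnected
  twoConnected_dual_restrict : (M✶ ↾ (M.E \ L)).TwoConnected
  two_le_eRk : 2 ≤ M.eRk L
  two_le_eRk_dual : 2 ≤ M✶.eRk (M.E \ L)

end Matroid

/-! Everything reduces to counting ranks. Write `r` for the rank of `M(G)` and `L = E(H)`. A
connected subgraph `K` has `r(E(K)) = |V(K)| - 1`, and an edge set living on a nonempty vertex set
`S` has rank at most `|S| - 1`. By the dual rank formula, `M*|(E \ L)` is 2-connected iff `r(L) +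
r(E) < r(L ∪ X) + r(L ∪ Y)` for every partition of `E \ L` into nonempty `X`, `Y`.

From graphs to matroids, the key is `TwoConnected.natRk_add_natRk_lt`. If a vertex `v` meets both
`X` and `Y` but not `L`, removing the star of `v` costs each of `L ∪ X` and `L ∪ Y` at least one,
but costs the whole graph exactly one, so submodularity gives the strict inequality. Connectedness
supplies `v`: in `H` for the restriction (with `L = ∅`), outside `H` for the dual.

Conversely, a cut vertex of `H`, an edge outside `H` with both ends in `H`, or a disconnected
complement of `V(H)` each gives a partition violating the inequality.

Condition 3 comes from `r*(E \ L) = |E(H̄)| - |V(H̄)| + |V(H) ∩ V(H̄)|`, where `H̄` is the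
complementary subgraph. -/

namespace Matroid

variable {β : Type*} {M : Matroid β} {L X Y : Set β}

/-! ### Natural-valued ranks and connectivity as strict rank inequalities. -/

/-- The rank of a set as a natural number, meaningful when the matroid is finite. -/
noncomputable def natRk (M : Matroid β) (X : Set β) : ℕ := (M.eRk X).toNat

@[simp] lemma natRk_empty (M : Matroid β) : M.natRk ∅ = 0 := by simp [natRk]

lemma coe_natRk (M : Matroid β) [M.RankFinite] (X : Set β) : (M.natRk X : ℕ∞) = M.eRk X :=
  ENat.natCast_toNat (eRk_ne_top_iff.2 (M.isRkFinite_set X))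

lemma natRk_mono (M : Matroid β) [M.RankFinite] (h : X ⊆ Y) : M.natRk X ≤ M.natRk Y := by
  have := M.eRk_mono h
  rw [← coe_natRk, ← coe_natRk] at this
  exact_mod_cast this

lemma natRk_inter_add_natRk_union_le (M : Matroid β) [M.RankFinite] (X Y : Set β) :
    M.natRk (X ∩ Y) + M.natRk (X ∪ Y) ≤ M.natRk X + M.natRk Y := by
  have := M.eRk_inter_add_eRk_union_le X Y
  simp only [← coe_natRk] at this
  exact_mod_cast this

lemma natRk_union_le (M : Matroid β) [M.RankFinite] (X Y : Set β) :
    M.natRk (X ∪ Y) ≤ M.natRk X + M.natRk Y :=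
  (Nat.le_add_left _ _).trans (M.natRk_inter_add_natRk_union_le X Y)

lemma IsBasis'.natRk_eq_ncard {I : Set β} (h : M.IsBasis' I X) : M.natRk X = I.ncard := by
  rw [natRk, h.eRk_eq_encard, ncard_def]

lemma Indep.ncard_le_natRk [M.RankFinite] {I : Set β} (h : M.Indep I) (hIX : I ⊆ X) :
    I.ncard ≤ M.natRk X := by
  have := h.encard_le_eRk_of_subset hIX
  rw [← coe_natRk, ← h.finite.cast_ncard_eq] at this
  exact_mod_cast this

lemma natRk_dual_add_natRk_ground (M : Matroid β) [M.Finite] (hX : X ⊆ M.E) :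
    M✶.natRk X + M.natRk M.E = M.natRk (M.E \ X) + X.ncard := by
  have := M.eRk_dual_add_eRank X hX
  rw [← eRk_ground, ← coe_natRk, ← coe_natRk, ← coe_natRk,
    ← (M.ground_finite.subset hX).cast_ncard_eq] at this
  exact_mod_cast this

lemma twoConnected_iff [M.RankFinite] :
    M.TwoConnected ↔ ∀ X Y, X.Nonempty → Y.Nonempty → Disjoint X Y → X ∪ Y = M.E →
      M.natRk M.E < M.natRk X + M.natRk Y := by
  refine ⟨fun h X Y hX hY hXY hE ↦ ?_, fun h X hX hXE ↦ ?_⟩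
  · have hY' : M.E \ X = Y := by rw [← hE, union_sdiff_left, hXY.sdiff_eq_right]
    have hss : X ⊂ M.E := ⟨hE ▸ subset_union_left, fun hle ↦ by
      rw [sdiff_eq_empty.2 hle] at hY'
      simp [← hY'] at hY⟩
    have h1 := h X hX hss
    rw [hY', ← coe_natRk, ← coe_natRk, ← coe_natRk] at h1
    have h2 := M.natRk_union_le X Y
    rw [hE] at h2
    refine lt_of_le_of_ne h2 fun h3 ↦ h1 (by exact_mod_cast h3)
  · have := h X (M.E \ X) hX (nonempty_of_ssubset hXE) disjoint_sdiff_right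
      (union_sdiff_cancel hXE.subset)
    rw [← coe_natRk, ← coe_natRk, ← coe_natRk]
    exact_mod_cast this.ne

lemma natRk_restrict_eq (M : Matroid β) (h : X ⊆ L) : (M ↾ L).natRk X = M.natRk X := by
  rw [natRk, restrict_eRk_eq _ h, natRk]

lemma twoConnected_restrict_iff [M.Finite] (hL : L ⊆ M.E) :
    (M ↾ L).TwoConnected ↔ ∀ X Y, X.Nonempty → Y.Nonempty → Disjoint X Y → X ∪ Y = L →
      M.natRk L < M.natRk X + M.natRk Y := by
  have : (M ↾ L).Finite := restrict_finite (M.ground_finite.subset hL)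
  rw [twoConnected_iff]
  refine forall₂_congr fun X Y ↦ forall₄_congr fun _ _ _ h ↦ ?_
  rw [restrict_ground_eq] at h ⊢
  rw [natRk_restrict_eq _ le_rfl, natRk_restrict_eq _ (h ▸ subset_union_left),
    natRk_restrict_eq _ (h ▸ subset_union_right)]

/-- Apply `r*(Z) = |Z| - r(E) + r(E \ Z)` to `X`, `Y` and `E \ L`: the complement of `X` is `L ∪ Y`
and vice versa, and the cardinalities cancel. The inequality expresses connectivity of the
contraction `M / L`, whose dual is `M*|(E \ L)`. -/
lemma twoConnected_dual_restrict_iff [M.Finite] (hL : L ⊆ M.E) :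
    (M✶ ↾ (M.E \ L)).TwoConnected ↔ ∀ X Y, X.Nonempty → Y.Nonempty → Disjoint X Y →
      X ∪ Y = M.E \ L → M.natRk L + M.natRk M.E < M.natRk (L ∪ X) + M.natRk (L ∪ Y) := by
  rw [twoConnected_restrict_iff (M := M✶) (L := M.E \ L) (sdiff_subset (s := M.E))]
  refine forall₂_congr fun X Y ↦ forall₄_congr fun _ _ hXY h ↦ ?_
  have hX : X ⊆ M.E \ L := h ▸ subset_union_left
  have hY : Y ⊆ M.E \ L := h ▸ subset_union_right
  have hmem : ∀ e, e ∈ X ∨ e ∈ Y ↔ e ∈ M.E ∧ e ∉ L := fun e ↦ by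
    rw [← mem_union, h, mem_sdiff]
  have hdj : ∀ e, e ∈ X → e ∉ Y := fun e h1 h2 ↦ hXY.notMem_of_mem_left h1 h2
  have h1 := M.natRk_dual_add_natRk_ground (X := M.E \ L) sdiff_subset
  have h2 := M.natRk_dual_add_natRk_ground (hX.trans sdiff_subset)
  have h3 := M.natRk_dual_add_natRk_ground (hY.trans sdiff_subset)
  have hX' : M.E \ X = L ∪ Y := by
    ext e
    have := hmem e; have := hdj e; have := @hL e
    simp only [mem_sdiff, mem_union]; tauto
  have hY' : M.E \ Y = L ∪ X := by
    ext e
    have := hmem e; have := hdj e; have := @hL e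
    simp only [mem_sdiff, mem_union]; tauto
  have hc : (M.E \ L).ncard = X.ncard + Y.ncard := by
    rw [← h, ncard_union_eq hXY (M.ground_finite.subset (hX.trans sdiff_subset))
      (M.ground_finite.subset (hY.trans sdiff_subset))]
  rw [sdiff_sdiff_cancel_left hL] at h1
  rw [hX'] at h2
  rw [hY'] at h3
  omega

lemma two_le_eRk_iff [M.RankFinite] : 2 ≤ M.eRk X ↔ 2 ≤ M.natRk X := by
  rw [← coe_natRk]
  exact_mod_cast Iff.rfl

end Matroid

/-! ### Ranks in the graphic matroid. -/

namespace Graph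

variable {α β : Type*} {G K : Graph α β} {F I J X Y P Q : Set β} {S : Set α} {e : β} {v w : α}

lemma reflTransGen_adj_mono (hKG : K ≤ G) (h : Relation.ReflTransGen K.Adj v w) :
    Relation.ReflTransGen G.Adj v w :=
  h.lift id fun _ _ hab ↦ hab.mono hKG

/-- A forest `I` on a finite vertex set `S` admits a choice of representatives of its components,
of which there are `|S| - |I|`. -/
lemma IsForestSet.exists_representatives (hS : S.Finite) (hI : I.Finite) (hF : G.IsForestSet I)
    (hIS : G.incidentVerts I ⊆ S) :
    ∃ ρ : α → α, (∀ e ∈ I, ∀ x y, G.IsLink e x y → ρ x = ρ y) ∧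
      (∀ v, Relation.ReflTransGen (G.restrict I).Adj v (ρ v)) ∧
      (ρ '' S).ncard + I.ncard = S.ncard := by
  classical
  induction I, hI using Set.Finite.induction_on with
  | empty => exact ⟨id, by simp, fun v ↦ .refl, by simp⟩
  | @insert e I heI hIfin ih =>
    obtain ⟨ρ, hρ, hr, hcard⟩ := ih (hF.subset (subset_insert _ _))
      fun x ⟨f, hf, hx⟩ ↦ hIS ⟨f, .inr hf, hx⟩
    obtain ⟨x, y, hxy⟩ := exists_isLink_of_mem_edgeSet (hF.1 (mem_insert e I))
    have hmono : ∀ {a b}, Relation.ReflTransGen (G.restrict I).Adj a b →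
        Relation.ReflTransGen (G.restrict (insert e I)).Adj a b := fun h ↦
      reflTransGen_adj_mono (restrict_mono_right G (subset_insert _ _)) h
    have hxS : x ∈ S := hIS ⟨e, mem_insert _ _, hxy.inc_left⟩
    have hyS : y ∈ S := hIS ⟨e, mem_insert _ _, hxy.inc_right⟩
    -- The new edge closes no cycle, so it joins two different components; the one of `y` is then
    -- given the representative of `x`.
    have hne : ρ x ≠ ρ y := fun h ↦
      not_acyclic_restrict_insert heI hxy ((hr x).trans (h ▸ reflTransGen_adj_symm (hr y))) hF.2
    refine ⟨fun v ↦ if ρ v = ρ y then ρ x else ρ v, ?_, fun v ↦ ?_, ?_⟩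
    · rintro f (rfl | hf) a b hab
      · rcases hab.eq_and_eq_or_eq_and_eq hxy with ⟨rfl, rfl⟩ | ⟨rfl, rfl⟩ <;> simp
      · simp only [hρ f hf a b hab]
    · by_cases h : ρ v = ρ y
      · simp only [h, if_true]
        refine (hmono (hr v)).trans ?_
        rw [h]
        refine (hmono (reflTransGen_adj_symm (hr y))).trans ?_
        exact .head ⟨e, mem_insert _ _, hxy.symm⟩ (hmono (hr x))
      · simpa only [h, if_false] using hmono (hr v)
    · have himg : (fun v ↦ if ρ v = ρ y then ρ x else ρ v) '' S = (ρ '' S) \ {ρ y} := by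
        ext a
        constructor
        · rintro ⟨b, hb, rfl⟩
          by_cases h : ρ b = ρ y
          · simpa only [h, if_true] using ⟨mem_image_of_mem ρ hxS, hne⟩
          · simpa only [h, if_false] using ⟨mem_image_of_mem ρ hb, h⟩
        · rintro ⟨⟨b, hb, rfl⟩, h⟩
          exact ⟨b, hb, if_neg h⟩
      rw [himg, ncard_insert_of_notMem heI hIfin]
      have := ncard_sdiff_singleton_add_one (mem_image_of_mem ρ hyS) (hS.image ρ)
      omega

lemma graphicMatroid_finite (hE : E(G).Finite) : G.graphicMatroid.Finite := ⟨hE⟩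

/-- A basis of `F` is a forest on `S`, and a nonempty `S` has at least one component. -/
lemma natRk_add_one_le (hE : E(G).Finite) (hS : S.Finite) (hne : S.Nonempty)
    (hFS : G.incidentVerts F ⊆ S) : G.graphicMatroid.natRk F + 1 ≤ S.ncard := by
  obtain ⟨I, hI⟩ := G.graphicMatroid.exists_isBasis' F
  obtain ⟨ρ, -, -, hρ⟩ := IsForestSet.exists_representatives hS (hE.subset hI.indep.1) hI.indep
    (fun x ⟨f, hf, hx⟩ ↦ hFS ⟨f, hI.subset hf, hx⟩)
  rw [hI.natRk_eq_ncard]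
  have := (ncard_pos (hS.image ρ)).2 (hne.image ρ)
  omega

/-- The ends of an edge of `F` are joined by a walk in every basis of `F`. -/
lemma reflTransGen_of_isBasis' (hI : G.graphicMatroid.IsBasis' I F) (heF : e ∈ F)
    (he : G.IsLink e v w) : Relation.ReflTransGen (G.restrict I).Adj v w := by
  by_contra hcon
  have hins : G.graphicMatroid.Indep (insert e I) :=
    ⟨insert_subset he.edge_mem hI.indep.1, acyclic_restrict_insert he hI.indep.2 hcon⟩
  have heI : e ∈ I := by
    by_contra heI
    exact hI.insert_not_indep ⟨heF, heI⟩ hins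
  exact hcon (.single ⟨e, heI, he⟩)

/-- Each edge of `K` can be replaced by a walk in a basis of `E(K)`, so the basis forest has a
single component on `V(K)`. -/
lemma Connected.natRk_edgeSet_add_one (hE : E(G).Finite) (hKG : K ≤ G) (hK : K.Connected)
    (hV : V(K).Finite) : G.graphicMatroid.natRk E(K) + 1 = V(K).ncard := by
  have hinc : G.incidentVerts E(K) ⊆ V(K) := fun x ⟨e, he, hx⟩ ↦
    ((hKG.inc_congr he).2 hx).vertex_mem
  obtain ⟨I, hI⟩ := G.graphicMatroid.exists_isBasis' E(K)
  obtain ⟨ρ, hρ, -, hcard⟩ := IsForestSet.exists_representatives hV (hE.subset hI.indep.1)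
    hI.indep (fun x ⟨f, hf, hx⟩ ↦ hinc ⟨f, hI.subset hf, hx⟩)
  have hwalk : ∀ {a b}, Relation.ReflTransGen (G.restrict I).Adj a b → ρ a = ρ b := by
    intro a b hab
    induction hab with
    | refl => rfl
    | tail _ h ih =>
      obtain ⟨f, hf⟩ := h
      exact ih.trans (hρ f hf.1 _ _ hf.2)
  have hwalkK : ∀ {a b}, Relation.ReflTransGen K.Adj a b → ρ a = ρ b := by
    intro a b hab
    induction hab with
    | refl => rfl
    | tail _ h ih =>
      obtain ⟨f, hf⟩ := h
      exact ih.trans (hwalk (reflTransGen_of_isBasis' hI hf.edge_mem (hf.mono hKG)))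
  obtain ⟨a, ha⟩ := hK.1
  have himg : ρ '' V(K) = {ρ a} := by
    ext b
    constructor
    · rintro ⟨c, hc, rfl⟩
      exact hwalkK (hK.2 c hc a ha)
    · rintro rfl
      exact mem_image_of_mem ρ ha
  rw [himg, ncard_singleton] at hcard
  rw [hI.natRk_eq_ncard]
  omega

/-- Deleting the edges at a vertex decreases the rank, if there is a non-loop among them. -/
lemma natRk_sdiff_inc_add_one_le (hE : E(G).Finite) (heX : e ∈ X) (he : G.IsLink e v w)
    (hvw : v ≠ w) :
    G.graphicMatroid.natRk (X \ {f | G.Inc f v}) + 1 ≤ G.graphicMatroid.natRk X := by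
  have := graphicMatroid_finite hE
  obtain ⟨I, hI⟩ := G.graphicMatroid.exists_isBasis' (X \ {f | G.Inc f v})
  have heI : e ∉ I := fun h ↦ (hI.subset h).2 he.inc_left
  -- No edge of `I` meets `v`, so `e` joins the isolated vertex `v` to another component.
  have hins : G.graphicMatroid.Indep (insert e I) := by
    refine ⟨insert_subset he.edge_mem hI.indep.1, acyclic_restrict_insert he hI.indep.2 fun h ↦ ?_⟩
    obtain h | ⟨z, ⟨f, hf⟩, -⟩ := h.cases_head
    · exact hvw h
    · exact (hI.subset hf.1).2 hf.2.inc_left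
  rw [hI.natRk_eq_ncard, ← ncard_insert_of_notMem heI hI.indep.finite]
  exact hins.ncard_le_natRk (insert_subset heX (hI.subset.trans sdiff_subset))

/-- The union of two forests that share at most one vertex is a forest. -/
lemma IsForestSet.union (hI : G.IsForestSet I) (hJ : G.IsForestSet J) (hJfin : J.Finite)
    (hIJ : Disjoint I J) (hv : G.incidentVerts I ∩ G.incidentVerts J ⊆ {v}) :
    G.IsForestSet (I ∪ J) := by
  classical
  induction J, hJfin using Set.Finite.induction_on with
  | empty => simpa using hI
  | @insert e J heJ hJfin ih =>
    have hsub : G.incidentVerts J ⊆ G.incidentVerts (insert e J) :=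
      fun x ⟨f, hf, hx⟩ ↦ ⟨f, .inr hf, hx⟩
    have hIJ' := ih (hJ.subset (subset_insert _ _)) (hIJ.mono_right (subset_insert _ _))
      ((inter_subset_inter_right _ hsub).trans hv)
    obtain ⟨x, y, hxy⟩ := exists_isLink_of_mem_edgeSet (hJ.1 (mem_insert e J))
    rw [union_insert]
    refine ⟨insert_subset hxy.edge_mem hIJ'.1, acyclic_restrict_insert hxy hIJ'.2 fun h ↦ ?_⟩
    set T := G.incidentVerts (insert e J) with hT
    -- Send every vertex outside `T` to `v`. Edges of `I` collapse to `v` and edges of `J` stay put,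
    -- so a walk between the ends of `e` becomes a walk in `J`.
    have hretract : ∀ {a b}, Relation.ReflTransGen (G.restrict (I ∪ J)).Adj a b →
        Relation.ReflTransGen (G.restrict J).Adj (if a ∈ T then a else v)
          (if b ∈ T then b else v) := by
      intro a b hab
      induction hab with
      | refl => exact .refl
      | @tail b c _ hbc ih =>
        refine ih.trans ?_
        obtain ⟨f, hf | hf, hbc⟩ := hbc
        · have key : ∀ u, G.Inc f u → (if u ∈ T then u else v) = v := by
            intro u hu
            split_ifs with huT
            · exact hv ⟨⟨f, hf, hu⟩, huT⟩
            · rfl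
          rw [key b hbc.inc_left, key c hbc.inc_right]
        · rw [if_pos (hsub ⟨f, hf, hbc.inc_left⟩), if_pos (hsub ⟨f, hf, hbc.inc_right⟩)]
          exact .single ⟨f, hf, hbc⟩
    have h' := hretract h
    rw [if_pos ⟨e, mem_insert _ _, hxy.inc_left⟩, if_pos ⟨e, mem_insert _ _, hxy.inc_right⟩] at h'
    exact not_acyclic_restrict_insert heJ hxy h' hJ.2

lemma natRk_add_natRk_le (hE : E(G).Finite) (hXY : Disjoint X Y)
    (hv : G.incidentVerts X ∩ G.incidentVerts Y ⊆ {v}) :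
    G.graphicMatroid.natRk X + G.graphicMatroid.natRk Y ≤ G.graphicMatroid.natRk (X ∪ Y) := by
  have := graphicMatroid_finite hE
  obtain ⟨I, hI⟩ := G.graphicMatroid.exists_isBasis' X
  obtain ⟨J, hJ⟩ := G.graphicMatroid.exists_isBasis' Y
  have hdj := hXY.mono hI.subset hJ.subset
  have hU : G.graphicMatroid.Indep (I ∪ J) := IsForestSet.union hI.indep hJ.indep hJ.indep.finite
    hdj fun x ⟨⟨f, hf, hx⟩, ⟨g, hg, hx'⟩⟩ ↦ hv ⟨⟨f, hI.subset hf, hx⟩, ⟨g, hJ.subset hg, hx'⟩⟩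
  rw [hI.natRk_eq_ncard, hJ.natRk_eq_ncard, ← ncard_union_eq hdj hI.indep.finite hJ.indep.finite]
  exact hU.ncard_le_natRk (union_subset_union hI.subset hJ.subset)

/-! ### Partitions of edges and vertices meeting both parts. -/

/-- If every edge in `P` and `Q` has an end in the connected subgraph `K`, whose edges are all in
`P ∪ Q`, then some vertex of `K` meets both `P` and `Q`. -/
lemma Preconnected.exists_common_incidentVert (hK : K.Preconnected) (hKG : K ≤ G)
    (hKPQ : E(K) ⊆ P ∪ Q) (hP : P.Nonempty) (hQ : Q.Nonempty)
    (hPQ : ∀ e ∈ P ∪ Q, ∃ x ∈ V(K), G.Inc e x) :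
    ∃ x ∈ V(K), x ∈ G.incidentVerts P ∧ x ∈ G.incidentVerts Q := by
  by_contra! hcon
  obtain ⟨p, hp⟩ := hP
  obtain ⟨q, hq⟩ := hQ
  obtain ⟨x, hxK, hx⟩ := hPQ p (.inl hp)
  obtain ⟨y, hyK, hy⟩ := hPQ q (.inr hq)
  have hwalk : ∀ {z}, Relation.ReflTransGen K.Adj x z → z ∈ G.incidentVerts P := by
    intro z hz
    induction hz with
    | refl => exact ⟨p, hp, hx⟩
    | @tail b c _ hbc ih =>
      obtain ⟨f, hf⟩ := hbc
      have hf' := hf.mono hKG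
      obtain hfP | hfQ := hKPQ hf.edge_mem
      · exact ⟨f, hfP, hf'.inc_right⟩
      · exact absurd ⟨f, hfQ, hf'.inc_left⟩ (hcon b hf.left_mem ih)
  exact hcon y hyK (hwalk (hK x hxK y hyK)) ⟨q, hq, hy⟩

lemma Preconnected.exists_isLink_crossing (hK : K.Preconnected) (hv : v ∈ V(K)) (hw : w ∈ V(K))
    (hvS : v ∈ S) (hwS : w ∉ S) : ∃ e x y, K.IsLink e x y ∧ x ∈ S ∧ y ∉ S := by
  by_contra! hcon
  have hwalk : ∀ {z}, Relation.ReflTransGen K.Adj v z → z ∈ S := by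
    intro z hz
    induction hz with
    | refl => exact hvS
    | tail _ hbc ih =>
      obtain ⟨f, hf⟩ := hbc
      exact hcon f _ _ hf ih
  exact hwS (hwalk (hK v hv w hw))

/-- Let `K` be a 2-connected subgraph of `G` with edge set `L ∪ X ∪ Y`, and let `v` be a vertex
that meets `X` and `Y`, but not `L`. Then `X` and `Y` are not separated in the contraction by
`L`. -/
lemma TwoConnected.natRk_add_natRk_lt {L : Set β} (hE : E(G).Finite) (hK : K.TwoConnected)
    (hKG : K ≤ G) (hVK : V(K).Finite) (hEK : E(K) = L ∪ (X ∪ Y)) (hvX : v ∈ G.incidentVerts X)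
    (hvY : v ∈ G.incidentVerts Y) (hvL : v ∉ G.incidentVerts L) :
    G.graphicMatroid.natRk L + G.graphicMatroid.natRk E(K) <
      G.graphicMatroid.natRk (L ∪ X) + G.graphicMatroid.natRk (L ∪ Y) := by
  have := graphicMatroid_finite hE
  have := hK.loopless
  obtain ⟨e, heX, w, hew⟩ := hvX
  obtain ⟨f, hfY, u, hfu⟩ := hvY
  have heK : K.IsLink e v w := (hKG.isLink_iff (hEK ▸ .inr (.inl heX))).2 hew
  have hfK : K.IsLink f v u := (hKG.isLink_iff (hEK ▸ .inr (.inr hfY))).2 hfu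
  -- Apply submodularity to the two sets without the star of `v`. Their intersection still contains
  -- `L`, and their union is `E(K - v)`, of rank `r(E(K)) - 1`; the two losses of at least one
  -- outweigh this single loss.
  have h1 := natRk_sdiff_inc_add_one_le hE (X := L ∪ X) (.inr heX) hew heK.ne
  have h2 := natRk_sdiff_inc_add_one_le hE (X := L ∪ Y) (.inr hfY) hfu hfK.ne
  have h3 := G.graphicMatroid.natRk_inter_add_natRk_union_le
    ((L ∪ X) \ {g | G.Inc g v}) ((L ∪ Y) \ {g | G.Inc g v})
  have h4 : G.graphicMatroid.natRk L ≤ G.graphicMatroid.natRk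
      (((L ∪ X) \ {g | G.Inc g v}) ∩ ((L ∪ Y) \ {g | G.Inc g v})) :=
    Matroid.natRk_mono _ fun g hg ↦
      ⟨⟨.inl hg, fun h ↦ hvL ⟨g, hg, h⟩⟩, ⟨.inl hg, fun h ↦ hvL ⟨g, hg, h⟩⟩⟩
  have h5 : ((L ∪ X) \ {g | G.Inc g v}) ∪ ((L ∪ Y) \ {g | G.Inc g v}) =
      E(K.deleteVerts {v}) := by
    rw [← union_sdiff_distrib, ← union_union_distrib_left, ← hEK, edgeSet_deleteVerts]
    ext g
    constructor
    · rintro ⟨hg, hgv⟩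
      obtain ⟨a, b, hab⟩ := exists_isLink_of_mem_edgeSet hg
      exact ⟨a, b, hab, fun h ↦ hgv (h ▸ (hab.mono hKG).inc_left),
        fun h ↦ hgv (h ▸ (hab.mono hKG).inc_right)⟩
    · rintro ⟨a, b, hab, ha, hb⟩
      refine ⟨hab.edge_mem, fun h ↦ ?_⟩
      obtain rfl | rfl := Inc.eq_or_eq_of_isLink h (hab.mono hKG)
      exacts [ha rfl, hb rfl]
  have hconn : (K.deleteVerts {v}).Connected :=
    ⟨⟨w, by simpa using ⟨heK.right_mem, heK.ne.symm⟩⟩,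
      hK.preconnected_deleteVerts v heK.left_mem⟩
  have h6 := hconn.natRk_edgeSet_add_one hE (deleteVerts_le.trans hKG)
    (by rw [vertexSet_deleteVerts]; exact hVK.subset sdiff_subset)
  have h7 := hK.connected.natRk_edgeSet_add_one hE hKG hVK
  rw [vertexSet_deleteVerts] at h6
  have h8 := ncard_sdiff_singleton_add_one heK.left_mem hVK
  rw [h5] at h3
  omega

end Graph

/-! ### The outside of `H`, and the passage from graph conditions to locked sets. -/

namespace Graph

variable {α β : Type*} {G H : Graph α β} {X Y : Set β} {S : Set α} {e : β} {v w : α}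

lemma IsInducedSubgraph.exists_inc_of_notMem (hHG : H.IsInducedSubgraph G) (he : e ∈ E(G))
    (heH : e ∉ E(H)) : ∃ x ∈ V(G) \ V(H), G.Inc e x := by
  obtain ⟨x, y, hxy⟩ := exists_isLink_of_mem_edgeSet he
  by_contra! hcon
  refine heH (hHG.isLink_of_mem_mem hxy ?_ ?_).edge_mem
  · by_contra hx
    exact hcon x ⟨hxy.left_mem, hx⟩ hxy.inc_left
  · by_contra hy
    exact hcon y ⟨hxy.right_mem, hy⟩ hxy.inc_right

lemma Connected.exists_inc (hG : G.Connected) (hnt : V(G).Nontrivial) (hv : v ∈ V(G)) :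
    ∃ e, G.Inc e v := by
  obtain ⟨w, hw, hne⟩ := hnt.exists_ne v
  obtain ⟨e, x, y, hxy, hx, -⟩ := hG.2.exists_isLink_crossing hv hw (mem_singleton v) hne
  exact ⟨e, hx ▸ hxy.inc_left⟩

/-- The vertices of the complementary subgraph that lie outside `H` are all the vertices outside
`H`. -/
lemma vertexSet_complementary_sdiff (hG : G.Connected) (hnt : V(G).Nontrivial) (hHG : H ≤ G) :
    V(G.complementary H) \ V(H) = V(G) \ V(H) := by
  ext x
  refine ⟨fun ⟨⟨e, _, hx⟩, hxH⟩ ↦ ⟨hx.vertex_mem, hxH⟩, fun ⟨hx, hxH⟩ ↦ ?_⟩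
  obtain ⟨e, he⟩ := hG.exists_inc hnt hx
  exact ⟨⟨e, ⟨he.edge_mem, fun h ↦ hxH ((hHG.inc_congr h).2 he).vertex_mem⟩, he⟩, hxH⟩

/-- Inclusion-exclusion: `V(H)` and the complementary vertices cover `V(G)`, since a vertex outside
`H` meets some edge of `G`, which cannot belong to `H`. -/
lemma ncard_vertexSet_complementary (hVfin : V(G).Finite) (hG : G.Connected)
    (hnt : V(G).Nontrivial) (hHG : H ≤ G) :
    V(G.complementary H).ncard + V(H).ncard =
      V(G).ncard + (V(H) ∩ V(G.complementary H)).ncard := by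
  have hsub : V(G.complementary H) ⊆ V(G) := fun x ⟨e, _, hx⟩ ↦ hx.vertex_mem
  have h1 := ncard_inter_add_ncard_sdiff_eq_ncard V(G.complementary H) V(H) (hVfin.subset hsub)
  have h2 := ncard_sdiff_add_ncard_of_subset hHG.vertexSet_mono hVfin
  rw [vertexSet_complementary_sdiff hG hnt hHG, inter_comm] at h1
  omega

lemma TwoConnected.matroid_restrict (hEfin : E(G).Finite) (hHG : H ≤ G) (hVH : V(H).Finite)
    (hH : H.TwoConnected) : (G.graphicMatroid ↾ E(H)).TwoConnected := by
  have := graphicMatroid_finite hEfin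
  rw [Matroid.twoConnected_restrict_iff (IsSubgraph.edgeSet_mono hHG)]
  intro X Y hX hY _ hXY
  obtain ⟨v, -, hvX, hvY⟩ := hH.connected.2.exists_common_incidentVert hHG hXY.ge hX hY
    fun e he ↦ by
      rw [hXY] at he
      obtain ⟨x, y, h⟩ := exists_isLink_of_mem_edgeSet he
      exact ⟨x, h.left_mem, (h.mono hHG).inc_left⟩
  have := hH.natRk_add_natRk_lt (L := ∅) hEfin hHG hVH (by rw [hXY, empty_union]) hvX hvY
    (by simp [incidentVerts])
  simpa using this

/-- As `H` is induced, every edge of `X ∪ Y` has an end outside `H`. The vertices there induce a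
connected graph, so one of them meets both `X` and `Y`, and it meets no edge of `H`. -/
lemma TwoConnected.matroid_dual_restrict (hVfin : V(G).Finite) (hEfin : E(G).Finite)
    (hG : G.TwoConnected) (hHG : H.IsInducedSubgraph G)
    (hcompl : (G.induce (V(G) \ V(H))).Connected) :
    (G.graphicMatroid✶ ↾ (G.graphicMatroid.E \ E(H))).TwoConnected := by
  have := graphicMatroid_finite hEfin
  have hHE : E(H) ⊆ E(G) := IsSubgraph.edgeSet_mono hHG.le
  rw [Matroid.twoConnected_dual_restrict_iff hHE]
  intro X Y hX hY _ hXY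
  rw [graphicMatroid_ground] at hXY ⊢
  have hvH : ∀ x ∈ V(G) \ V(H), x ∉ G.incidentVerts E(H) := fun x hx ⟨e, he, h⟩ ↦
    hx.2 ((hHG.le.inc_congr he).2 h).vertex_mem
  have hsub : E(G.induce (V(G) \ V(H))) ⊆ X ∪ Y := by
    rintro e ⟨x, y, h, hx, -⟩
    rw [hXY]
    exact ⟨h.edge_mem, fun he ↦ hvH x hx ⟨e, he, h.inc_left⟩⟩
  obtain ⟨v, hv, hvX, hvY⟩ := hcompl.2.exists_common_incidentVert (G.induce_le sdiff_subset) hsub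
    hX hY fun e he ↦ by
      rw [hXY] at he
      exact hHG.exists_inc_of_notMem he.1 he.2
  exact hG.natRk_add_natRk_lt hEfin le_rfl hVfin (by rw [hXY, union_sdiff_cancel hHE]) hvX hvY
    (hvH v hv)

/-- A proper induced subgraph with at least two vertices of a 2-connected graph has at least two
vertices of attachment. -/
lemma TwoConnected.two_le_ncard_attachments (hVfin : V(G).Finite) (hG : G.TwoConnected)
    (hHG : H ≤ G) (hH : V(H).Nontrivial) (hne : (V(G) \ V(H)).Nonempty) :
    2 ≤ (V(H) ∩ V(G.complementary H)).ncard := by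
  obtain ⟨w, hw, hwH⟩ := hne
  obtain ⟨u, hu⟩ := hH.nonempty
  have hmem : ∀ {e x y}, G.IsLink e x y → x ∈ V(H) → y ∉ V(H) →
      x ∈ V(H) ∩ V(G.complementary H) := fun {e x y} h hx hy ↦
    ⟨hx, e, ⟨h.edge_mem, fun he ↦ hy ((hHG.inc_congr he).2 h.inc_right).vertex_mem⟩, h.inc_left⟩
  have hV := hHG.vertexSet_mono
  obtain ⟨e, x, y, hxy, hx, hy⟩ := hG.connected.2.exists_isLink_crossing (hV hu) hw hu hwH
  obtain ⟨u', hu', hne'⟩ := hH.exists_ne x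
  -- Since `x` is not a cut vertex, some edge leaves `V(H)` even after deleting `x`; its end in `H`
  -- is a second attachment.
  obtain ⟨f, x', y', hxy', hx', hy'⟩ :=
    (hG.preconnected_deleteVerts x hxy.left_mem).exists_isLink_crossing (S := V(H))
      (v := u') (w := w) (by simpa using ⟨hV hu', hne'⟩)
      (by simpa using ⟨hw, fun h ↦ hwH (h ▸ hx)⟩) hu' hwH
  rw [deleteVerts_isLink] at hxy'
  have : ({x, x'} : Set α) ⊆ V(H) ∩ V(G.complementary H) := by
    rintro z (rfl | rfl)
    exacts [hmem hxy hx hy, hmem hxy'.1 hx' hy']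
  rw [← ncard_pair (Ne.symm hxy'.2.1)]
  exact ncard_le_ncard this (hVfin.subset (inter_subset_left.trans hV))

/-- If `H` is induced and the vertices outside `H` induce a connected subgraph, then a spanning
tree of that subgraph, together with an edge at each vertex of attachment of `H`, lies outside
`H`. -/
lemma IsInducedSubgraph.ncard_add_ncard_attachments_le (hVfin : V(G).Finite) (hEfin : E(G).Finite)
    (hHG : H.IsInducedSubgraph G) (hcompl : (G.induce (V(G) \ V(H))).Connected) :
    (V(G) \ V(H)).ncard + (V(H) ∩ V(G.complementary H)).ncard ≤ (E(G) \ E(H)).ncard + 1 := by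
  have := graphicMatroid_finite hEfin
  set K := G.induce (V(G) \ V(H)) with hK
  have hKG : K ≤ G := G.induce_le sdiff_subset
  have h1 : G.graphicMatroid.natRk E(K) + 1 = (V(G) \ V(H)).ncard :=
    hcompl.natRk_edgeSet_add_one hEfin hKG (hVfin.subset sdiff_subset)
  have hKE : E(K) ⊆ E(G) := IsSubgraph.edgeSet_mono hKG
  obtain ⟨I, hI⟩ := G.graphicMatroid.exists_isBasis' E(K)
  have h2 : G.graphicMatroid.natRk E(K) ≤ E(K).ncard := by
    rw [hI.natRk_eq_ncard]
    exact ncard_le_ncard hI.subset (hEfin.subset hKE)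
  have hKout : E(K) ⊆ E(G) \ E(H) := by
    rintro e ⟨x, y, h, hx, -⟩
    exact ⟨h.edge_mem, fun he ↦ hx.2 ((hHG.le.inc_congr he).2 h.inc_left).vertex_mem⟩
  have hch : ∀ x ∈ V(H) ∩ V(G.complementary H), ∃ e, e ∈ (E(G) \ E(H)) \ E(K) ∧ G.Inc e x := by
    rintro x ⟨hxH, e, he, hex⟩
    refine ⟨e, ⟨he, ?_⟩, hex⟩
    rintro ⟨a, b, hab, ha, hb⟩
    obtain rfl | rfl := hex.eq_or_eq_of_isLink hab
    exacts [ha.2 hxH, hb.2 hxH]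
  have h3 : (V(H) ∩ V(G.complementary H)).ncard ≤ ((E(G) \ E(H)) \ E(K)).ncard := by
    obtain hemp | ⟨x₀, hx₀⟩ := (V(H) ∩ V(G.complementary H)).eq_empty_or_nonempty
    · simp [hemp]
    have : Nonempty β := ⟨(hch x₀ hx₀).choose⟩
    choose! g hg using hch
    refine ncard_le_ncard_of_injOn g (fun x hx ↦ (hg x hx).1) (fun x hx y hy hxy ↦ ?_)
      (hEfin.subset (sdiff_subset.trans sdiff_subset))
    -- An edge chosen for two different attachments would have both ends in `H`, but it also has an
    -- end outside `H`.
    by_contra hne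
    obtain ⟨z, hz, hez⟩ := hHG.exists_inc_of_notMem (hg x hx).1.1.1 (hg x hx).1.1.2
    obtain h | h | h := Inc.eq_or_eq_or_eq (hg x hx).2 (hxy ▸ (hg y hy).2) hez
    · exact hne h
    · exact hz.2 (h ▸ hx.1)
    · exact hz.2 (h ▸ hy.1)
  have h4 := ncard_sdiff_add_ncard_of_subset hKout (hEfin.subset sdiff_subset)
  omega

/-- The rank of the complement of `E(H)` in the dual of the graphic matroid. -/
lemma natRk_dual_edgeSet_sdiff (hVfin : V(G).Finite) (hEfin : E(G).Finite) (hG : G.Connected)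
    (hHG : H ≤ G) (hH : H.Connected) :
    G.graphicMatroid✶.natRk (E(G) \ E(H)) + V(G).ncard = V(H).ncard + (E(G) \ E(H)).ncard := by
  have := graphicMatroid_finite hEfin
  have h1 := G.graphicMatroid.natRk_dual_add_natRk_ground (X := E(G) \ E(H)) sdiff_subset
  rw [graphicMatroid_ground, sdiff_sdiff_cancel_left (IsSubgraph.edgeSet_mono hHG)] at h1
  have h2 := hG.natRk_edgeSet_add_one hEfin le_rfl hVfin
  have h3 := hH.natRk_edgeSet_add_one hEfin hHG (hVfin.subset hHG.vertexSet_mono)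
  omega

/-! ### From locked sets back to graph conditions. -/

/-- A subgraph without isolated vertices whose edge set is connected in the graphic matroid is
connected after the deletion of any vertex. -/
lemma preconnected_deleteVerts_of_matroid (hEfin : E(G).Finite) (hHG : H ≤ G)
    (hiso : ∀ x ∈ V(H), ∃ e, H.Inc e x) (hM : (G.graphicMatroid ↾ E(H)).TwoConnected) (v : α) :
    (H.deleteVerts {v}).Preconnected := by
  have := graphicMatroid_finite hEfin
  rw [Matroid.twoConnected_restrict_iff (IsSubgraph.edgeSet_mono hHG)] at hM
  intro x hx y hy
  by_contra hcon
  set S : Set α := {z | Relation.ReflTransGen (H.deleteVerts {v}).Adj x z} with hS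
  have hxS : x ∈ S := .refl
  have hstep : ∀ {e a b}, H.IsLink e a b → a ∈ S → a ≠ v → b ≠ v → b ∈ S := fun h ha hav hbv ↦
    Relation.ReflTransGen.tail ha ⟨_, (deleteVerts_isLink ..).2 ⟨h, hav, hbv⟩⟩
  have hSv : v ∉ S := by
    intro h
    rw [hS, mem_ofPred_eq] at h
    obtain h | ⟨z, -, e, he⟩ := h.cases_tail
    · exact (by simpa using hx : x ∈ V(H) ∧ x ≠ v).2 h.symm
    · exact ((deleteVerts_isLink ..).1 he).2.2 rfl
  rw [vertexSet_deleteVerts] at hx hy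
  set X : Set β := {e | ∃ a ∈ S, H.Inc e a} with hX
  have hXE : X ⊆ E(H) := fun e ⟨a, _, h⟩ ↦ h.edge_mem
  -- `S` is the component of `x` in `H - v`, so the edges meeting `S` share at most `v` with the
  -- others, and the ranks of the two parts add up to that of `E(H)`.
  have hinc : G.incidentVerts X ∩ G.incidentVerts (E(H) \ X) ⊆ {v} := by
    rintro z ⟨⟨e, heX, hez⟩, ⟨f, hfY, hfz⟩⟩
    by_contra hzv
    have hez' := (hHG.inc_congr (hXE heX)).2 hez
    have hfz' := (hHG.inc_congr hfY.1).2 hfz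
    refine hfY.2 ⟨z, ?_, hfz'⟩
    obtain ⟨a, ha, b, hab⟩ := heX
    obtain rfl | rfl := hez'.eq_or_eq_of_isLink hab
    · exact ha
    · exact hstep hab ha (fun h ↦ hSv (h ▸ ha)) hzv
  obtain ⟨e, he⟩ := hiso x hx.1
  obtain ⟨f, hf⟩ := hiso y hy.1
  have hfX : f ∉ X := by
    rintro ⟨a, ha, b, hab⟩
    obtain rfl | rfl := hf.eq_or_eq_of_isLink hab
    · exact hcon ha
    · exact hcon (hstep hab ha (fun h ↦ hSv (h ▸ ha)) hy.2)
  have h1 := hM X (E(H) \ X) ⟨e, x, hxS, he⟩ ⟨f, hf.edge_mem, hfX⟩ disjoint_sdiff_right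
    (union_sdiff_cancel hXE)
  have h2 := natRk_add_natRk_le hEfin disjoint_sdiff_right hinc
  rw [union_sdiff_cancel hXE] at h2
  omega

lemma three_le_ncard_vertexSet (hEfin : E(G).Finite) (hHG : H ≤ G) (hVH : V(H).Finite)
    (hr : 2 ≤ G.graphicMatroid.natRk E(H)) : 3 ≤ V(H).ncard := by
  have hne : V(H).Nonempty := by
    rw [nonempty_iff_ne_empty]
    intro hemp
    have hE : E(H) = ∅ := by
      rw [eq_empty_iff_forall_notMem]
      intro e he
      obtain ⟨x, y, h⟩ := exists_isLink_of_mem_edgeSet he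
      exact (hemp ▸ h.left_mem : x ∈ (∅ : Set α))
    rw [hE, Matroid.natRk_empty] at hr
    omega
  have := natRk_add_one_le hEfin hVH hne (F := E(H))
    fun x ⟨e, he, hx⟩ ↦ ((hHG.inc_congr he).2 hx).vertex_mem
  omega

lemma twoConnected_of_matroid (hEfin : E(G).Finite) (hG : G.Loopless) (hHG : H ≤ G)
    (hiso : ∀ x ∈ V(H), ∃ e, H.Inc e x) (hM : (G.graphicMatroid ↾ E(H)).TwoConnected)
    (hcard : 3 ≤ V(H).ncard) : H.TwoConnected := by
  have hdel := preconnected_deleteVerts_of_matroid hEfin hHG hiso hM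
  refine ⟨⟨nonempty_of_ncard_ne_zero (by omega), fun x hx y hy ↦ ?_⟩, hG.anti hHG,
    fun v _ ↦ hdel v⟩
  -- Deleting a third vertex leaves `x` and `y` joined, so `H` itself is connected.
  obtain ⟨z, hz, hzxy⟩ : ∃ z ∈ V(H), z ∉ ({x, y} : Set α) := by
    refine exists_mem_notMem_of_ncard_lt_ncard (lt_of_le_of_lt ?_ hcard)
    simpa using ncard_insert_le x {y}
  simp only [mem_insert_iff, mem_singleton_iff, not_or] at hzxy
  exact reflTransGen_adj_mono deleteVerts_le
    (hdel z x (by simpa using ⟨hx, Ne.symm hzxy.1⟩) y (by simpa using ⟨hy, Ne.symm hzxy.2⟩))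

/-- If the complement of `E(H)` is connected and of rank at least two in the dual of the graphic
matroid, then a connected subgraph `H` is induced. -/
lemma isInducedSubgraph_of_matroid (hVfin : V(G).Finite) (hEfin : E(G).Finite)
    (hG : G.Connected) (hHG : H ≤ G) (hH : H.Connected)
    (hM : (G.graphicMatroid✶ ↾ (G.graphicMatroid.E \ E(H))).TwoConnected)
    (hr : 2 ≤ G.graphicMatroid✶.natRk (E(G) \ E(H))) : H.IsInducedSubgraph G := by
  have := graphicMatroid_finite hEfin
  have hHE : E(H) ⊆ E(G) := IsSubgraph.edgeSet_mono hHG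
  rw [Matroid.twoConnected_dual_restrict_iff hHE, graphicMatroid_ground] at hM
  refine ⟨hHG, fun e x y hxy hx hy ↦ ?_⟩
  by_contra hcon
  have heH : e ∉ E(H) := fun h ↦ hcon ((hHG.isLink_iff h).2 hxy)
  -- With both ends in `V(H)`, the edge `e` does not raise the rank of `E(H)`: it is a loop of the
  -- contraction, so `{e}` would be separated from the rest.
  have hHr := hH.natRk_edgeSet_add_one hEfin hHG (hVfin.subset hHG.vertexSet_mono)
  have hle := natRk_add_one_le (F := insert e E(H)) hEfin (hVfin.subset hHG.vertexSet_mono) hH.1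
    (by
      rintro z ⟨f, rfl | hf, hz⟩
      · obtain rfl | rfl := hz.eq_or_eq_of_isLink hxy <;> assumption
      · exact ((hHG.inc_congr hf).2 hz).vertex_mem)
  have hdual := natRk_dual_edgeSet_sdiff hVfin hEfin hG hHG hH
  have hVle := ncard_le_ncard hHG.vertexSet_mono hVfin
  have hemem : e ∈ E(G) \ E(H) := ⟨hxy.edge_mem, heH⟩
  -- Since `|V(H)| ≤ |V(G)|`, the dual rank formula `hdual` and `hr` give at least two edges outside
  -- `H`.
  have hYne : ((E(G) \ E(H)) \ {e}).Nonempty := by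
    rw [nonempty_iff_ne_empty]
    intro hemp
    have h1 := ncard_sdiff_singleton_add_one hemem (hEfin.subset sdiff_subset)
    rw [hemp, ncard_empty] at h1
    omega
  have h1 := hM {e} ((E(G) \ E(H)) \ {e}) (singleton_nonempty e) hYne disjoint_sdiff_right
    (union_sdiff_cancel (singleton_subset_iff.2 hemem))
  rw [union_singleton] at h1
  have h2 : G.graphicMatroid.natRk (E(H) ∪ (E(G) \ E(H)) \ {e}) ≤ G.graphicMatroid.natRk E(G) :=
    Matroid.natRk_mono _ (union_subset hHE (sdiff_subset.trans sdiff_subset))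
  omega

/-- Otherwise take a component `A` outside `H` and let `X` be the edges meeting `A`. Then `E(H) ∪ X`
lives on `V(H) ∪ A` and the other part, with `E(H)`, on `V(G) \ A`. The rank bounds sum to `|V(H)| +
|V(G)| - 2 = r(E(H)) + r(E(G))`, contradicting strictness. -/
lemma connected_induce_sdiff_of_matroid (hVfin : V(G).Finite) (hEfin : E(G).Finite)
    (hG : G.Connected) (hHG : H.IsInducedSubgraph G) (hH : H.Connected)
    (hne : (V(G) \ V(H)).Nonempty)
    (hM : (G.graphicMatroid✶ ↾ (G.graphicMatroid.E \ E(H))).TwoConnected) :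
    (G.induce (V(G) \ V(H))).Connected := by
  have := graphicMatroid_finite hEfin
  have hHV := hHG.le.vertexSet_mono
  have hHE : E(H) ⊆ E(G) := IsSubgraph.edgeSet_mono hHG.le
  rw [Matroid.twoConnected_dual_restrict_iff hHE, graphicMatroid_ground] at hM
  refine ⟨hne, fun x hx y hy ↦ ?_⟩
  by_contra hcon
  set A : Set α := {z | Relation.ReflTransGen (G.induce (V(G) \ V(H))).Adj x z} with hA
  have hAsub : A ⊆ V(G) \ V(H) := by
    intro z hz
    rw [hA, mem_ofPred_eq] at hz
    obtain rfl | ⟨u, -, e, he⟩ := hz.cases_tail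
    · exact hx
    · exact he.2.2
  have hxA : x ∈ A := .refl
  have hstep : ∀ {e a b}, G.IsLink e a b → a ∈ A → b ∉ V(H) → b ∈ A := fun h ha hb ↦
    Relation.ReflTransGen.tail ha ⟨_, h, hAsub ha, h.right_mem, hb⟩
  set X : Set β := {e | ∃ a ∈ A, G.Inc e a} with hX
  have hXE : X ⊆ E(G) \ E(H) := fun e ⟨a, ha, h⟩ ↦
    ⟨h.edge_mem, fun he ↦ (hAsub ha).2 ((hHG.le.inc_congr he).2 h).vertex_mem⟩
  have hnt : V(G).Nontrivial := ⟨x, hx.1, y, hy.1, fun h ↦ hcon (h ▸ .refl)⟩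
  obtain ⟨e, he⟩ := hG.exists_inc hnt hx.1
  obtain ⟨f, hf⟩ := hG.exists_inc hnt hy.1
  have hincX : ∀ z, z ∈ G.incidentVerts (E(H) ∪ X) → z ∈ V(H) ∪ A := by
    rintro z ⟨g, hg | ⟨a, ha, b, hab⟩, hz⟩
    · exact .inl ((hHG.le.inc_congr hg).2 hz).vertex_mem
    · obtain rfl | rfl := hz.eq_or_eq_of_isLink hab
      · exact .inr ha
      · by_cases hzH : z ∈ V(H)
        · exact .inl hzH
        · exact .inr (hstep hab ha hzH)
  have hincY : ∀ z, z ∈ G.incidentVerts (E(H) ∪ (E(G) \ E(H)) \ X) → z ∈ V(G) \ A := by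
    rintro z ⟨g, hg | ⟨-, hg⟩, hz⟩
    · exact ⟨hz.vertex_mem, fun hzA ↦ (hAsub hzA).2 ((hHG.le.inc_congr hg).2 hz).vertex_mem⟩
    · exact ⟨hz.vertex_mem, fun hzA ↦ hg ⟨z, hzA, hz⟩⟩
  have hfX : f ∉ X := fun hfX ↦ by
    obtain h | h := hincX y ⟨f, .inr hfX, hf⟩
    exacts [hy.2 h, hcon h]
  have hfH : f ∉ E(H) := fun h ↦ hy.2 ((hHG.le.inc_congr h).2 hf).vertex_mem
  have h1 := hM X ((E(G) \ E(H)) \ X) ⟨e, x, hxA, he⟩ ⟨f, ⟨hf.edge_mem, hfH⟩, hfX⟩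
    disjoint_sdiff_right (union_sdiff_cancel hXE)
  have hAfin : A.Finite := hVfin.subset (hAsub.trans sdiff_subset)
  have h2 := natRk_add_one_le (S := V(H) ∪ A) hEfin ((hVfin.subset hHV).union hAfin)
    ⟨x, .inr hxA⟩ hincX
  have h3 := natRk_add_one_le (S := V(G) \ A) hEfin (hVfin.subset sdiff_subset)
    ⟨y, hy.1, fun h ↦ hcon h⟩ hincY
  have h4 := ncard_union_eq (disjoint_right.2 fun a ha ↦ (hAsub ha).2) (hVfin.subset hHV) hAfin
  have h5 := ncard_sdiff_add_ncard_of_subset (hAsub.trans sdiff_subset) hVfin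
  have h6 := hG.natRk_edgeSet_add_one hEfin le_rfl hVfin
  have h7 := hH.natRk_edgeSet_add_one hEfin hHG.le (hVfin.subset hHV)
  omega

end Graph

theorem theorem2p3 {α β : Type*} (G H : Graph α β)
    (hVfin : V(G).Finite) (hEfin : E(G).Finite)
    (hG : G.TwoConnected) (hHG : H ≤ G) :
    ((∀ x ∈ V(H), ∃ e, H.Inc e x) ∧ G.graphicMatroid.IsLocked E(H)) ↔
      (H.IsInducedSubgraph G ∧ H.TwoConnected) ∧
      (3 ≤ V(H).ncard ∧ V(H).ncard + 1 ≤ V(G).ncard) ∧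
      (V(G.complementary H).ncard ≤ E(G.complementary H).ncard ∨
        3 ≤ (V(H) ∩ V(G.complementary H)).ncard) ∧
      (G.induce (V(G) \ V(H))).Connected := by
  have := Graph.graphicMatroid_finite hEfin
  have hVH := hVfin.subset hHG.vertexSet_mono
  have hVle := ncard_le_ncard hHG.vertexSet_mono hVfin
  have hcard := ncard_sdiff_add_ncard_of_subset hHG.vertexSet_mono hVfin
  rw [Graph.edgeSet_complementary]
  constructor
  · rintro ⟨hiso, hL⟩
    have hr := Matroid.two_le_eRk_iff.1 hL.two_le_eRk
    have hr' : 2 ≤ G.graphicMatroid✶.natRk (E(G) \ E(H)) :=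
      Matroid.two_le_eRk_iff.1 hL.two_le_eRk_dual
    have h3 := Graph.three_le_ncard_vertexSet hEfin hHG hVH hr
    have hH := Graph.twoConnected_of_matroid hEfin hG.loopless hHG hiso hL.twoConnected_restrict h3
    have hind := Graph.isInducedSubgraph_of_matroid hVfin hEfin hG.connected hHG hH.connected
      hL.twoConnected_dual_restrict hr'
    have hdual := Graph.natRk_dual_edgeSet_sdiff hVfin hEfin hG.connected hHG hH.connected
    have hne : (V(G) \ V(H)).Nonempty := by
      obtain ⟨e, he⟩ : (E(G) \ E(H)).Nonempty := by
        rw [nonempty_iff_ne_empty]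
        intro hemp
        rw [hemp, ncard_empty] at hdual
        rw [hemp, Matroid.natRk_empty] at hr'
        omega
      obtain ⟨x, hx, -⟩ := hind.exists_inc_of_notMem he.1 he.2
      exact ⟨x, hx⟩
    have hpos := (ncard_pos (hVfin.subset sdiff_subset)).2 hne
    have hnt : V(G).Nontrivial := (one_lt_ncard_iff_nontrivial_and_finite.1 (by omega)).1
    have hcompl := Graph.ncard_vertexSet_complementary hVfin hG.connected hnt hHG
    -- For condition 3, `hdual` and `hcompl` express the dual rank as `|E(H̄)| - |V(H̄)|` plus the
    -- number of attachments; if the difference is negative, dual rank at least 2 forces three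
    -- attachments.
    exact ⟨⟨hind, hH⟩, ⟨h3, by omega⟩, by omega, Graph.connected_induce_sdiff_of_matroid hVfin hEfin
      hG.connected hind hH.connected hne hL.twoConnected_dual_restrict⟩
  · rintro ⟨⟨hind, hH⟩, ⟨h3, hlt⟩, hor, hconn⟩
    have hntH : V(H).Nontrivial := (one_lt_ncard_iff_nontrivial_and_finite.1 (by omega)).1
    have hnt := hntH.mono hHG.vertexSet_mono
    have hdual := Graph.natRk_dual_edgeSet_sdiff hVfin hEfin hG.connected hHG hH.connected
    have hrank := hH.connected.natRk_edgeSet_add_one hEfin hHG hVH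
    have hcompl := Graph.ncard_vertexSet_complementary hVfin hG.connected hnt hHG
    have hatt := hG.two_le_ncard_attachments hVfin hHG hntH hconn.1
    have htree := hind.ncard_add_ncard_attachments_le hVfin hEfin hconn
    refine ⟨fun x hx ↦ hH.connected.exists_inc hntH hx, Graph.IsSubgraph.edgeSet_mono hHG,
      hH.matroid_restrict hEfin hHG hVH, hG.matroid_dual_restrict hVfin hEfin hind hconn, ?_, ?_⟩
    · rw [Matroid.two_le_eRk_iff]
      omega
    -- By the same formula: if `|E(H̄)| ≥ |V(H̄)|`, the two attachments of `hatt` suffice; with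
    -- three attachments, the bound `|E(H̄)| ≥ |V(H̄)| - 1` from `htree` is enough.
    · rw [Matroid.two_le_eRk_iff, Graph.graphicMatroid_ground]
      omega
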